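/- Let $D\subset\mathbb R^d$ be a bounded open set. For $E\subset\mathbb R^d$ let $\mathrm{Cap}(E)$ be the infimum of $\int_{\mathbb R^d}(|\nabla u|^2+u^2)\,dx$ over all $u\in H^1(\mathbb R^d)$ with $u\ge 1$ almost everywhere in a neighbourhood of $E$. A property holds quasi-everywhere if it holds outside a set of zero capacity. A set $A\subset\mathbb R^d$ is quasi-open if for every $\varepsilon>0$ there is an open set $U$ with $\mathrm{Cap}(U\,\triangle\,A)<\varepsilon$; a function $f:D\to\mathbb R$ is quasi-continuous if for every $\varepsilon>0$ there is a continuous $f_\varepsilon:D\to\mathbb R$ with $\mathrm{Cap}(\{f\ne f_\varepsilon\})<\varepsilon$. Functions in $H^1_0(D)$ are identified with their quasi-continuous representatives. For quasi-open $A\subset D$, let $H^1_0(A)$ be the set of all $u\in H^1_0(D)$ with $u=0$ quasi-everywhere on $D\setminus A$, and let $w_A\in H^1_0(A)$ be the weak solution of $-\Delta w_A=1$ in $A$, i.e. $\int_D\nabla w_A\cdot\nabla v\,dx=\int_D v\,dx$ for all $v\in H^1_0(A)$. A sequence $(A_n)$ of quasi-open subsets of $D$ is said to $w\gamma$-converge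 to a quasi-open set $A\subset D$ if $w_{A_n}$ converges weakly in $H^1_0(D)$ to some (quasi-continuous) $w\in H^1_0(D)$ with $A=\{w>0\}$. **Proposition.** Let $(A_n)$ be a sequence of quasi-open subsets of $D$ which $w\gamma$-converges to a quasi-open set $A\subset D$. Let $\Omega_n$ and $\Omega$ be Lebesgue measurable subsets of $\mathbb R^d$ such that $A_n\subset\Omega_n$ for every $n$ and $1_{\Omega_n}\to 1_\Omega$ in $L^1(D)$. Then $|A\setminus\Omega|=0$, where $|\cdot|$ denotes Lebesgue measure. -/

import Mathlib

open MeasureTheory Filter Topology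
open scoped ENNReal ContDiff

/-- The space `C_c^∞(D)` of smooth functions with compact support contained in `D`. -/
structure IsTestFunction {d : ℕ} (D : Set (EuclideanSpace ℝ (Fin d)))
    (φ : EuclideanSpace ℝ (Fin d) → ℝ) : Prop where
  contDiff : ContDiff ℝ ∞ φ
  hasCompactSupport : HasCompactSupport φ
  tsupport_subset : tsupport φ ⊆ D

/-- `u` belongs to `H^1(ℝ^d)` and `g` is its weak gradient. -/
structure IsSobolevH1 {d : ℕ} (u : EuclideanSpace ℝ (Fin d) → ℝ)
    (g : EuclideanSpace ℝ (Fin d) → EuclideanSpace ℝ (Fin d)) : Prop where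
  memLp : MemLp u 2 volume
  memLp_grad : MemLp g 2 volume
  integral_eq : ∀ φ : EuclideanSpace ℝ (Fin d) → ℝ, IsTestFunction Set.univ φ → ∀ i : Fin d,
    ∫ x, u x * fderiv ℝ φ x (EuclideanSpace.single i 1) = - ∫ x, g x i * φ x

/-- `Cap(E)`: the infimum of `∫ |∇u|² + u²` over all `u ∈ H^1(ℝ^d)` such that `u ≥ 1` almost
everywhere in a neighbourhood of `E`. The infimum of the empty family is `∞`. -/
noncomputable def sobolevCap {d : ℕ} (E : Set (EuclideanSpace ℝ (Fin d))) : ℝ≥0∞ :=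
  ⨅ (u : EuclideanSpace ℝ (Fin d) → ℝ)
    (g : EuclideanSpace ℝ (Fin d) → EuclideanSpace ℝ (Fin d))
    (_ : IsSobolevH1 u g ∧ ∃ U : Set (EuclideanSpace ℝ (Fin d)),
      IsOpen U ∧ E ⊆ U ∧ ∀ᵐ x ∂volume, x ∈ U → 1 ≤ u x),
    ∫⁻ x, ‖g x‖ₑ ^ 2 + ‖u x‖ₑ ^ 2

/-- `A` is quasi-open: it differs from an open set by a set of arbitrarily small capacity. -/
def IsQuasiOpen {d : ℕ} (A : Set (EuclideanSpace ℝ (Fin d))) : Prop :=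
  ∀ ε : ℝ≥0∞, 0 < ε → ∃ U : Set (EuclideanSpace ℝ (Fin d)),
    IsOpen U ∧ sobolevCap (symmDiff U A) < ε

/-- `f : D → ℝ` is quasi-continuous: it agrees with a continuous function on `D` outside a set of
arbitrarily small capacity. The values of `f` outside `D` are irrelevant. -/
def QuasiContinuousOn {d : ℕ} (f : EuclideanSpace ℝ (Fin d) → ℝ)
    (D : Set (EuclideanSpace ℝ (Fin d))) : Prop :=
  ∀ ε : ℝ≥0∞, 0 < ε → ∃ h : EuclideanSpace ℝ (Fin d) → ℝ,
    ContinuousOn h D ∧ sobolevCap {x ∈ D | f x ≠ h x} < ε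

/-- The Hilbert space `L²(D) × L²(D; ℝ^d)`, in which a Sobolev function `u` is represented by the
pair `(u, ∇u)`; its norm on such a pair is the `H^1(D)` norm. -/
abbrev SobolevPair {d : ℕ} (D : Set (EuclideanSpace ℝ (Fin d))) : Type :=
  WithLp 2 (Lp ℝ 2 (volume.restrict D) × Lp (EuclideanSpace ℝ (Fin d)) 2 (volume.restrict D))

/-- `H^1_0(D)`, the closure of `C_c^∞(D)` in the `H^1(D)` norm. The pairs `(φ, ∇φ)` with
`φ ∈ C_c^∞(D)` already form a linear subspace, so the span only supplies the structure. -/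
noncomputable def sobolevH10 {d : ℕ} (D : Set (EuclideanSpace ℝ (Fin d))) :
    Submodule ℝ (SobolevPair D) :=
  (Submodule.span ℝ {p : SobolevPair D | ∃ φ : EuclideanSpace ℝ (Fin d) → ℝ,
    IsTestFunction D φ ∧ p.fst =ᵐ[volume.restrict D] φ ∧
      p.snd =ᵐ[volume.restrict D] gradient φ}).topologicalClosure

/-- `v` is a quasi-continuous representative on `D` of the function `u ∈ H^1_0(D)`. -/
def IsQuasiContinuousRep {d : ℕ} (D : Set (EuclideanSpace ℝ (Fin d))) (u : sobolevH10 D)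
    (v : EuclideanSpace ℝ (Fin d) → ℝ) : Prop :=
  QuasiContinuousOn v D ∧ u.1.fst =ᵐ[volume.restrict D] v

/-- For quasi-open `Ω ⊆ D`, the space `H^1_0(Ω)` of all `u ∈ H^1_0(D)` (identified with a
quasi-continuous representative) such that `u = 0` quasi-everywhere on `D \ Ω`. -/
def quasiH10 {d : ℕ} (D Ω : Set (EuclideanSpace ℝ (Fin d))) : Set (sobolevH10 D) :=
  {u | ∃ v : EuclideanSpace ℝ (Fin d) → ℝ, IsQuasiContinuousRep D u v ∧
    sobolevCap {x ∈ D \ Ω | v x ≠ 0} = 0}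

/-- `u` is the weak solution `R_Ω(f)` of `-Δu = f` in `Ω`, `u ∈ H^1_0(Ω)`, for `f ∈ L²(D)`. -/
def IsDirichletSolution {d : ℕ} (D Ω : Set (EuclideanSpace ℝ (Fin d)))
    (f : EuclideanSpace ℝ (Fin d) → ℝ) (u : sobolevH10 D) : Prop :=
  u ∈ quasiH10 D Ω ∧ ∀ v ∈ quasiH10 D Ω,
    ∫ x in D, inner ℝ (u.1.snd x) (v.1.snd x) = ∫ x in D, f x * v.1.fst x

/-- Weak `γ`-convergence of `A n` to `B` in `D`: the solutions `R_{A n}(1)` converge weakly in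
`H^1_0(D)` to some `w` with `B = {w > 0}`, where `w` is taken quasi-continuous. -/
def WeakGammaConverges {d : ℕ} (D : Set (EuclideanSpace ℝ (Fin d)))
    (A : ℕ → Set (EuclideanSpace ℝ (Fin d))) (B : Set (EuclideanSpace ℝ (Fin d))) : Prop :=
  ∃ (u : ℕ → sobolevH10 D) (w : sobolevH10 D) (v : EuclideanSpace ℝ (Fin d) → ℝ),
    (∀ n, IsDirichletSolution D (A n) (fun _ => 1) (u n)) ∧
    Tendsto (fun n => toWeakSpace ℝ (sobolevH10 D) (u n)) atTop
      (𝓝 (toWeakSpace ℝ (sobolevH10 D) w)) ∧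
    IsQuasiContinuousRep D w v ∧ B = {x ∈ D | 0 < v x}

/-! Test `w_{A_n}` against the indicator of `{w > 0} \ Ω_n`. The integral is zero for every `n`,
since `w_{A_n}` vanishes a.e. on `D \ A_n` (capacity dominates Lebesgue measure) and `A_n ⊆ Ω_n`.
The indicators converge strongly in `L²(D)` and `w_{A_n}` converges weakly there, so the integral of
`w` over `{w > 0} \ Ω` is zero. The integrand is positive on that set, which is therefore null. -/

/-- In a Hilbert space,
inner products of a weakly convergent and a norm convergent sequence converge. -/
theorem tendsto_inner_of_weak_of_strong {H : Type*} [NormedAddCommGroup H] [InnerProductSpace ℝ H]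
    [CompleteSpace H] {a : ℕ → H} {a₀ : H} {b : ℕ → H} {b₀ : H}
    (ha : ∀ y, Tendsto (fun n => inner ℝ (a n) y) atTop (𝓝 (inner ℝ a₀ y)))
    (hb : Tendsto b atTop (𝓝 b₀)) :
    Tendsto (fun n => inner ℝ (a n) (b n)) atTop (𝓝 (inner ℝ a₀ b₀)) := by
  -- Weak convergence forces norm boundedness, so pairing with `b n - b₀` costs at most `C * ‖b n -
  -- b₀‖`.
  obtain ⟨C, hC⟩ : ∃ C, ∀ n, ‖innerSL ℝ (a n)‖ ≤ C := by
    refine banach_steinhaus fun y => ?_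
    obtain ⟨C, hC⟩ := (ha y).norm.bddAbove_range
    exact ⟨C, fun n => hC ⟨n, rfl⟩⟩
  have hzero : Tendsto (fun n => inner ℝ (a n) (b n - b₀)) atTop (𝓝 0) := by
    refine squeeze_zero_norm (a := fun n => C * ‖b n - b₀‖) (fun n => ?_) ?_
    · refine (norm_inner_le_norm _ _).trans ?_
      gcongr
      simpa using hC n
    · simpa using (tendsto_iff_norm_sub_tendsto_zero.1 hb).const_mul C
  simpa [inner_sub_right] using hzero.add (ha b₀)

/-- Lebesgue measure is bounded by the Sobolev capacity. -/
theorem volume_le_sobolevCap {d : ℕ} (E : Set (EuclideanSpace ℝ (Fin d))) :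
    volume E ≤ sobolevCap E := by
  refine le_iInf fun u => le_iInf fun g => le_iInf fun ⟨_, U, hU, hEU, h1⟩ => ?_
  calc volume E ≤ volume U := measure_mono hEU
    _ = ∫⁻ _ in U, 1 := by simp
    _ ≤ ∫⁻ x in U, ‖g x‖ₑ ^ 2 + ‖u x‖ₑ ^ 2 := by
      refine lintegral_mono_ae ((ae_restrict_iff' hU.measurableSet).2 ?_)
      filter_upwards [h1] with x hx hxU
      have : (1 : ℝ≥0∞) ≤ ‖u x‖ₑ := by
        rw [← ofReal_norm, ← ENNReal.ofReal_one]
        exact ENNReal.ofReal_le_ofReal ((hx hxU).trans (le_abs_self _))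
      exact (one_le_pow₀ this).trans le_add_self
    _ ≤ _ := setLIntegral_le_lintegral _ _

/-- An element of `H^1_0(A)` vanishes almost everywhere on `D \ A`. -/
theorem ae_eq_zero_of_mem_quasiH10 {d : ℕ} {D A : Set (EuclideanSpace ℝ (Fin d))}
    (hD : MeasurableSet D) {u : sobolevH10 D} (hu : u ∈ quasiH10 D A) :
    ∀ᵐ x ∂volume.restrict D, x ∉ A → u.1.fst x = 0 := by
  obtain ⟨v, ⟨-, huv⟩, hv⟩ := hu
  have hnull : volume {x ∈ D \ A | v x ≠ 0} = 0 :=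
    le_antisymm ((volume_le_sobolevCap _).trans hv.le) bot_le
  filter_upwards [huv, ae_restrict_of_ae (measure_eq_zero_iff_ae_notMem.1 hnull),
    ae_restrict_mem hD] with x hx hxn hxD hxA
  rw [hx]
  by_contra hne
  exact hxn ⟨⟨hxD, hxA⟩, hne⟩

/-- The measure of a symmetric difference is the `L^1` distance of the indicators. -/
theorem measure_symmDiff_eq_eLpNorm_indicator_sub {α : Type*} [MeasurableSpace α] {μ : Measure α}
    {s t : Set α} (hs : MeasurableSet s) (ht : MeasurableSet t) :
    μ (symmDiff s t) =
      eLpNorm (fun x => s.indicator (fun _ => (1 : ℝ)) x - t.indicator (fun _ => (1 : ℝ)) x) 1 μ := by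
  rw [eLpNorm_one_eq_lintegral_enorm, ← lintegral_indicator_one (hs.symmDiff ht)]
  refine lintegral_congr fun x => ?_
  by_cases h1 : x ∈ s <;> by_cases h2 : x ∈ t <;> simp [h1, h2, Set.mem_symmDiff]

/-- If `a n` vanishes off `T n`, converges weakly in `L^2` to `a₀`, and `T n → T` in measure, then
`a₀` is not positive off `T`. -/
theorem measure_pos_diff_eq_zero_of_weak {α : Type*} [MeasurableSpace α] {μ : Measure α}
    [IsFiniteMeasure μ] {a : ℕ → Lp ℝ 2 μ} {a₀ : Lp ℝ 2 μ} {T : ℕ → Set α} {T₀ : Set α}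
    (hT : ∀ n, MeasurableSet (T n)) (hT₀ : MeasurableSet T₀)
    (hconv : Tendsto (fun n => μ (symmDiff (T n) T₀)) atTop (𝓝 0))
    (ha : ∀ y, Tendsto (fun n => inner ℝ (a n) y) atTop (𝓝 (inner ℝ a₀ y)))
    (hzero : ∀ n, ∀ᵐ x ∂μ, x ∉ T n → a n x = 0) :
    μ ({x | 0 < a₀ x} \ T₀) = 0 := by
  have hS : MeasurableSet {x | 0 < a₀ x} :=
    measurableSet_lt measurable_const (Lp.stronglyMeasurable a₀).measurable
  set S := {x | 0 < a₀ x}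
  have hb : Tendsto (fun n => indicatorConstLp 2 (hS.diff (hT n)) (measure_ne_top μ _) (1 : ℝ))
      atTop (𝓝 (indicatorConstLp 2 (hS.diff hT₀) (measure_ne_top μ _) (1 : ℝ))) := by
    refine tendsto_indicatorConstLp_set (by simp) ?_
    -- Removing `T n` and `T₀` from the same set `S` cannot enlarge their symmetric difference.
    refine tendsto_of_tendsto_of_tendsto_of_le_of_le tendsto_const_nhds hconv
      (fun n => bot_le) fun n => measure_mono fun x => ?_
    simp only [Set.mem_symmDiff, Set.mem_sdiff]
    tauto
  have hlim := tendsto_inner_of_weak_of_strong ha hb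
  have hn : ∀ n, inner ℝ (a n)
      (indicatorConstLp 2 (hS.diff (hT n)) (measure_ne_top μ _) (1 : ℝ)) = 0 := by
    intro n
    rw [real_inner_comm, L2.inner_indicatorConstLp_one]
    refine setIntegral_eq_zero_of_ae_eq_zero ?_
    filter_upwards [hzero n] with x hx hxS using hx hxS.2
  simp only [hn] at hlim
  have h0 := tendsto_nhds_unique tendsto_const_nhds hlim
  rw [real_inner_comm, L2.inner_indicatorConstLp_one] at h0
  by_contra hne
  have hpos := (setIntegral_pos_iff_support_of_nonneg_ae (μ := μ) (s := S \ T₀) (f := a₀)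
    ((ae_restrict_iff' (hS.diff hT₀)).2 (ae_of_all _ fun x hx => le_of_lt hx.1))
    ((Lp.memLp a₀).integrable (by norm_num)).integrableOn).2 (by
      rw [Set.inter_eq_right.2 (show S \ T₀ ⊆ Function.support a₀ from fun x hx => ne_of_gt hx.1)]
      exact pos_iff_ne_zero.2 hne)
  exact hpos.ne h0

theorem proposition4p12 {d : ℕ} (D : Set (EuclideanSpace ℝ (Fin d)))
    (hD : IsOpen D) (hDb : Bornology.IsBounded D)
    (A : ℕ → Set (EuclideanSpace ℝ (Fin d))) (A' : Set (EuclideanSpace ℝ (Fin d)))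
    (hA : ∀ n, IsQuasiOpen (A n) ∧ A n ⊆ D) (hA' : IsQuasiOpen A' ∧ A' ⊆ D)
    (hconv : WeakGammaConverges D A A')
    (Ω : ℕ → Set (EuclideanSpace ℝ (Fin d))) (Ω' : Set (EuclideanSpace ℝ (Fin d)))
    (hΩ : ∀ n, NullMeasurableSet (Ω n) volume) (hΩ' : NullMeasurableSet Ω' volume)
    (hsub : ∀ n, A n ⊆ Ω n)
    (hL1 : Tendsto (fun n => eLpNorm
      (fun x => (Ω n).indicator (fun _ => (1 : ℝ)) x - Ω'.indicator (fun _ => (1 : ℝ)) x)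
      1 (volume.restrict D)) atTop (𝓝 0)) :
    volume (A' \ Ω') = 0 := by
  obtain ⟨u, w, v, hu, hw, ⟨-, hwv⟩, rfl⟩ := hconv
  have : IsFiniteMeasure (volume.restrict D) := ⟨by simpa using hDb.measure_lt_top⟩
  -- Null measurable sets are replaced by a.e. equal measurable ones; every later use is insensitive
  -- to null sets.
  choose T hTm hTae using fun n => (hΩ n).exists_measurable_superset_ae_eq.imp fun _ h => h.2
  obtain ⟨T₀, -, hT₀m, hT₀ae⟩ := hΩ'.exists_measurable_superset_ae_eq
  have hTconv : Tendsto (fun n => volume.restrict D (symmDiff (T n) T₀)) atTop (𝓝 0) := by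
    refine hL1.congr fun n => ?_
    rw [measure_symmDiff_eq_eLpNorm_indicator_sub (hTm n) hT₀m]
    refine eLpNorm_congr_ae (ae_restrict_of_ae ?_)
    filter_upwards [indicator_ae_eq_of_ae_eq_set (f := fun _ => (1 : ℝ)) (hTae n),
      indicator_ae_eq_of_ae_eq_set (f := fun _ => (1 : ℝ)) hT₀ae] with x h1 h2
    rw [h1, h2]
  have hweak : ∀ y, Tendsto (fun n => inner ℝ (u n).1.fst y) atTop (𝓝 (inner ℝ w.1.fst y)) := by
    intro y
    -- Pairing the function component with `y` is a bounded functional on `H^1_0(D)`, so weak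
    -- convergence there passes to `L²(D)`.
    let ℓ : sobolevH10 D →L[ℝ] ℝ :=
      (innerSL ℝ y).comp ((WithLp.fstL 2 ℝ _ _).comp (sobolevH10 D).subtypeL)
    have hℓ := ((WeakBilin.eval_continuous (topDualPairing ℝ (sobolevH10 D)).flip ℓ).tendsto
      (toWeakSpace ℝ (sobolevH10 D) w)).comp hw
    simp only [real_inner_comm y]
    exact hℓ
  have hzero : ∀ n, ∀ᵐ x ∂volume.restrict D, x ∉ T n → (u n).1.fst x = 0 := by
    intro n
    filter_upwards [ae_eq_zero_of_mem_quasiH10 hD.measurableSet (hu n).1,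
      ae_restrict_of_ae (hTae n)] with x hx hxT hxn
    exact hx fun hxA => hxn (hxT.mpr (hsub n hxA))
  have hkey := measure_pos_diff_eq_zero_of_weak hTm hT₀m hTconv hweak hzero
  have hnull := (ae_restrict_iff' hD.measurableSet).1 (measure_eq_zero_iff_ae_notMem.1 hkey)
  rw [measure_eq_zero_iff_ae_notMem]
  filter_upwards [hnull, (ae_restrict_iff' hD.measurableSet).1 hwv, hT₀ae] with x hx hxv hxT hmem
  obtain ⟨⟨hxD, hpos⟩, hxΩ⟩ := hmem
  refine hx hxD ⟨?_, fun hxT₀ => hxΩ (hxT.mp hxT₀)⟩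
  rw [Set.mem_ofPred_eq, hxv hxD]
  exact hpos
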